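/- Let $n\ge 1$ and $h\ge 0$ be integers. In the random-order secretary problem with a sample of size $h$ ($h$-RO-SP), an adversary picks a set $C$ of $n+h$ candidates with distinct values in $\mathbb{R}_{\ge 0}$. A subset $H\subseteq C$ of cardinality $h$ is drawn uniformly at random and its values are revealed to the online player as an unordered set. The remaining $n$ candidates $O=C\setminus H$ are then presented one by one, in a uniformly random order; the player sees the value of each arriving candidate and must immediately and irrevocably accept or reject it. The process ends when a candidate is accepted. The player knows $n$ and $h$ and may use internal randomness. Let $\mathrm{ALG}(C)$ be the value of the accepted candidate ($0$ if none is accepted) and $\mathrm{OPT}(C)=\max O$. An online algorithm is $c$-competitive if $\mathbb{E}[\mathrm{ALG}(C)]\ge c\cdot\mathbb{E}[\mathrm{OPT}(C)]$ for every set $C$ of $n+h$ candidates, where the expectations are over $H$, the arrival order, and the internal randomness of the algorithm. Then every online algorithm for the $h$-RO-SP with $n$ online candidates has competitive ratio at most $$\begin{cases}\dfrac1e\cdot\dfrac{n+h}{n}+\dfrac1n & \text{if } \dfrac{h}{n+h}\le\dfrac1e,\\[2mm] \dfrac hn\ln\!\left(\dfrac{h+n}{h}\right)+\dfrac1n & \text{otherwise;}\end{cases}$$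 that is, if the algorithm is $c$-competitive, then $c$ is at most this quantity. -/

import Mathlib

open MeasureTheory
open scoped NNReal BigOperators

/-- A randomized algorithm for the online player in the game with `n` online rounds. `Ω` is the
sample space of the internal randomness. Given the history set `H`, in round `j` (rounds are
`0, …, n - 1`) the player has seen the values `x 0, …, x j` of the candidates that arrived so far,
in order of arrival, and `accept ω H j x` tells whether the current candidate, whose value is `x j`,
is accepted if it is reached. For each fixed input, the decision is a random variable on `Ω`;
nothing is assumed about the dependence on the values. -/
structure OnlineAlgorithm (n : ℕ) (Ω : Type*) [MeasurableSpace Ω] where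
  accept : Ω → Finset ℝ≥0 → (j : Fin n) → (Fin (j.val + 1) → ℝ≥0) → Bool
  measurable_accept : ∀ (H : Finset ℝ≥0) (j : Fin n) (x : Fin (j.val + 1) → ℝ≥0),
    Measurable fun ω => accept ω H j x

namespace OnlineAlgorithm

variable {n : ℕ} {Ω : Type*} [MeasurableSpace Ω]

/-- The values that have arrived up to and including round `j`, if the arrival sequence is `x`. -/
def seen (x : Fin n → ℝ≥0) (j : Fin n) : Fin (j.val + 1) → ℝ≥0 :=
  fun i => x (Fin.castLE j.isLt i)

/-- The player accepts the candidate of round `j`, having rejected all the earlier ones. -/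
def StopsAt (A : OnlineAlgorithm n Ω) (ω : Ω) (H : Finset ℝ≥0) (x : Fin n → ℝ≥0)
    (j : Fin n) : Prop :=
  A.accept ω H j (seen x j) = true ∧ ∀ i : Fin n, i < j → A.accept ω H i (seen x i) = false

open scoped Classical in
/-- The value of the accepted candidate (at most one round `j` satisfies `StopsAt`), and `0` if no
candidate is accepted. -/
noncomputable def payoff (A : OnlineAlgorithm n Ω) (ω : Ω) (H : Finset ℝ≥0)
    (x : Fin n → ℝ≥0) : ℝ :=
  ∑ j : Fin n, if A.StopsAt ω H x j then (x j : ℝ) else 0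

/-- The expected value of the accepted candidate on the set `C` of candidates (identified with
their values), in the random-order game with history sets of size `h`: the average over the
`h`-element history sets `H ⊆ C`, over the orderings `σ` of the online set `C \ H`, and over the
internal randomness of the algorithm. -/
noncomputable def expectedValue (A : OnlineAlgorithm n Ω) (μ : Measure Ω) (h : ℕ)
    (C : Finset ℝ≥0) : ℝ :=
  𝔼 H ∈ C.powersetCard h, 𝔼 σ : Fin n ≃ ↥(C \ H),
    ∫ ω, A.payoff ω H (fun i => (σ i : ℝ≥0)) ∂μ

end OnlineAlgorithm

/-- The expected value of the best candidate in the online set `C \ H`, where `H` is a uniformly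
random `h`-element subset of `C`. -/
noncomputable def expectedOpt (h : ℕ) (C : Finset ℝ≥0) : ℝ :=
  𝔼 H ∈ C.powersetCard h, (((C \ H).sup id : ℝ≥0) : ℝ)

/-- The algorithm is `c`-competitive for the random-order secretary problem with a sample of size
`h` and `n` online candidates: on every set of `n + h` candidates with distinct nonnegative values,
its expected value is at least `c` times that of the best online candidate. -/
def OnlineAlgorithm.IsCompetitive {n : ℕ} {Ω : Type*} [MeasurableSpace Ω]
    (A : OnlineAlgorithm n Ω) (μ : Measure Ω) (h : ℕ) (c : ℝ) : Prop :=
  ∀ C : Finset ℝ≥0, C.card = n + h → c * expectedOpt h C ≤ A.expectedValue μ h C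

/-! Fix the internal randomness and average over a family of instances, as in Yao's principle. The
candidates have values `M ^ m` with `m` in `{1, …, K}`. Any candidate other than the best of `C` is
worth at most a fraction `1 / M` of it, and the best one is online with probability `n / (n + h)`.
Hence `c * n / (n + h)` is, up to `1 / M`, at most the probability of accepting the best element of
all of `C`.

The sets `C` are weighted by `setWeight` so that the values reveal nothing beyond relative ranks:
given `k` elements, the next one is a record with relative weight `1 / (k + 1)`. What remains is the
classical secretary problem with `N = n + h` candidates, the first `h` of which cannot be taken. A
record at position `k + 1` is the overall maximum with probability `(k + 1) / N`, so backward
induction (`winWeight_le`) bounds the winning probability by any `B h` with `IsValueBound N B`. The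
explicit solution `secretaryBound` (`isValueBound_secretaryBound`) gives the two cases of the
theorem.

These weights are not normalizable as `K → ∞`: their total mass is a harmonic sum. Its divergence
makes the boundary terms negligible (`le_of_mul_harmonic_le`) in the inequality of `competitive_le`;
afterwards `M → ∞`. -/

/-! ### Weights on finite sets of integers -/

/-- The weight of a `k`-element set of positive integers with maximum `m`. With these weights, a new
element is a record with probability exactly `1 / (k + 1)`, whatever the set is. -/
noncomputable def setWeight (k m : ℕ) : ℝ := 1 / (k * m.descFactorial k)

lemma setWeight_nonneg (k m : ℕ) : 0 ≤ setWeight k m := by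
  unfold setWeight; positivity

/-- Mass of the non-records. Equality holds for `k < m`; for `m = k` no unused integer lies below
the maximum and mass is lost. -/
lemma mul_setWeight_succ_le {k : ℕ} (hk : 0 < k) (m : ℕ) :
    ((m - k : ℕ) : ℝ) * setWeight (k + 1) m ≤ k / (k + 1) * setWeight k m := by
  rcases le_or_gt m k with hmk | hmk
  · rw [Nat.sub_eq_zero_of_le hmk]
    have := setWeight_nonneg k m
    simp only [Nat.cast_zero, zero_mul]
    positivity
  · unfold setWeight
    rw [Nat.descFactorial_succ]
    have h1 : (0 : ℝ) < ((m - k : ℕ) : ℝ) := by exact_mod_cast Nat.sub_pos_of_lt hmk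
    have h2 : (0 : ℝ) < (m.descFactorial k : ℝ) := by
      exact_mod_cast Nat.pos_of_ne_zero (by rw [Ne, Nat.descFactorial_eq_zero_iff_lt]; omega)
    have h3 : (0 : ℝ) < k := by exact_mod_cast hk
    apply le_of_eq
    push_cast
    field_simp

/-- Mass of the records. The sum telescopes, since `setWeight (k + 1) v` is the decrease of
`setWeight k` from `v - 1` to `v`, divided by `k + 1`; truncation at `K` only loses mass. -/
lemma sum_setWeight_succ_le {k m : ℕ} (hk : 0 < k) (hkm : k ≤ m) (K : ℕ) :
    ∑ v ∈ Finset.Ioc m K, setWeight (k + 1) v ≤ setWeight k m / (k + 1) := by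
  rcases le_or_gt m K with hmK | hmK
  · have h3 : (0 : ℝ) < k := by exact_mod_cast hk
    suffices h : ∑ v ∈ Finset.Ioc m K, setWeight (k + 1) v
        = setWeight k m / (k + 1) - setWeight k K / (k + 1) by
      rw [h]
      have := setWeight_nonneg k K
      have : 0 ≤ setWeight k K / (k + 1) := by positivity
      linarith
    induction K, hmK using Nat.le_induction with
    | base => simp
    | succ K hmK ih =>
      rw [← Finset.insert_Ioc_right_eq_Ioc_add_one hmK, Finset.sum_insert (by simp), ih]
      unfold setWeight
      obtain ⟨d, rfl⟩ := Nat.exists_eq_add_of_le (hkm.trans hmK)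
      have h2 : (0 : ℝ) < ((k + d).descFactorial k : ℝ) := by
        exact_mod_cast Nat.pos_of_ne_zero (by rw [Ne, Nat.descFactorial_eq_zero_iff_lt]; omega)
      have e1 : ((k + d + 1).descFactorial (k + 1) : ℝ) = (k + d + 1) * (k + d).descFactorial k := by
        rw [Nat.succ_descFactorial_succ]; push_cast; ring
      have e2 : ((k + d + 1).descFactorial k : ℝ) * (d + 1)
          = (k + d + 1) * (k + d).descFactorial k := by
        have := Nat.succ_descFactorial (k + d) k
        rw [show k + d + 1 - k = d + 1 by omega] at this
        have h' := congrArg (Nat.cast : ℕ → ℝ) this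
        push_cast at h'
        linarith
      have e3 : ((k + d + 1).descFactorial k : ℝ)
          = (k + d + 1) * (k + d).descFactorial k / (d + 1) := by
        rw [← e2]; field_simp
      rw [e1, e3]
      push_cast
      field_simp
      ring
  · rw [Finset.Ioc_eq_empty (by omega), Finset.sum_empty]
    have := setWeight_nonneg k m
    positivity

/-- There are `(m - 1).choose k` sets of size `k + 1` with maximum `m`; their weights, times `(k +
1)!`, add up to `1 / m`. -/
lemma sum_powersetCard_setWeight (k K : ℕ) :
    ((k + 1).factorial : ℝ) *
        ∑ C ∈ (Finset.Icc 1 K).powersetCard (k + 1), setWeight (k + 1) (C.sup id)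
      = ∑ m ∈ Finset.Icc (k + 1) K, (1 / m : ℝ) := by
  induction K with
  | zero =>
    rw [Finset.powersetCard_eq_empty.2 (by simp)]
    simp
  | succ K ih =>
    have hnot : K + 1 ∉ Finset.Icc 1 K := by simp
    rw [← Finset.insert_Icc_right_eq_Icc_add_one (by omega),
      Finset.powersetCard_succ_insert hnot, Finset.sum_union, mul_add, ih]
    · have hsup : ∀ D ∈ (Finset.Icc 1 K).powersetCard k, (insert (K + 1) D).sup id = K + 1 := by
        intro D hD
        rw [Finset.sup_insert]
        refine max_eq_left (Finset.sup_le fun i hi => ?_)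
        have := Finset.mem_Icc.1 ((Finset.mem_powersetCard.1 hD).1 hi)
        simp only [id]; omega
      rw [Finset.sum_image, Finset.sum_congr rfl fun D hD => congrArg (setWeight (k + 1)) (hsup D hD),
        Finset.sum_const, Finset.card_powersetCard, Nat.card_Icc]
      · rcases lt_or_ge K k with hk | hk
        · rw [Finset.Icc_eq_empty (by omega), Finset.Icc_eq_empty (by omega),
            Nat.choose_eq_zero_of_lt (by omega)]
          simp
        · rw [← Finset.insert_Icc_right_eq_Icc_add_one (by omega), Finset.sum_insert (by simp),
            add_comm]
          congr 1
          unfold setWeight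
          rw [Nat.succ_descFactorial_succ, Nat.factorial_succ, Nat.add_sub_cancel,
            Nat.descFactorial_eq_factorial_mul_choose]
          have h1 : (0 : ℝ) < (K.choose k : ℝ) := by exact_mod_cast Nat.choose_pos hk
          have h2 : (0 : ℝ) < (k.factorial : ℝ) := by positivity
          rw [nsmul_eq_mul]
          push_cast
          field_simp
      · intro D hD D' hD' heq
        have hD1 : K + 1 ∉ D := fun hm => hnot ((Finset.mem_powersetCard.1 hD).1 hm)
        have hD2 : K + 1 ∉ D' := fun hm => hnot ((Finset.mem_powersetCard.1 hD').1 hm)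
        rw [← Finset.erase_insert hD1, ← Finset.erase_insert hD2]
        exact congrArg (fun s => Finset.erase s (K + 1)) heq
    · rw [Finset.disjoint_left]
      intro D hD hD'
      obtain ⟨E, -, rfl⟩ := Finset.mem_image.1 hD'
      exact hnot ((Finset.mem_powersetCard.1 hD).1 (Finset.mem_insert_self _ _))

/-! ### Arrival sequences and records -/

/-- The injective sequences of length `n` in `W`. -/
noncomputable def injSeqs (n : ℕ) (W : Finset ℕ) : Finset (Fin n → ℕ) :=
  open scoped Classical in
  (Fintype.piFinset fun _ => W).filter Function.Injective

lemma mem_injSeqs {n : ℕ} {W : Finset ℕ} {x : Fin n → ℕ} :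
    x ∈ injSeqs n W ↔ (∀ i, x i ∈ W) ∧ Function.Injective x := by
  simp [injSeqs]

lemma sum_injSeqs_succ {n : ℕ} (W : Finset ℕ) (f : (Fin (n + 1) → ℕ) → ℝ) :
    ∑ x ∈ injSeqs (n + 1) W, f x
      = ∑ v ∈ W, ∑ y ∈ injSeqs n (W.erase v), f (Fin.cons v y) := by
  rw [Finset.sum_sigma']
  refine Finset.sum_bij' (fun x _ => ⟨x 0, Fin.tail x⟩) (fun p _ => Fin.cons p.1 p.2)
    ?_ ?_ ?_ ?_ ?_
  · intro x hx
    rw [mem_injSeqs] at hx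
    simp only [Finset.mem_sigma, mem_injSeqs, Finset.mem_erase]
    refine ⟨hx.1 0, fun i => ⟨fun h => ?_, hx.1 _⟩, fun i j hij => ?_⟩
    · exact Fin.succ_ne_zero i (hx.2 h)
    · exact Fin.succ_injective _ (hx.2 hij)
  · rintro ⟨v, y⟩ hp
    simp only [Finset.mem_sigma, mem_injSeqs, Finset.mem_erase] at hp
    rw [mem_injSeqs, Fin.cons_injective_iff]
    refine ⟨fun i => ?_, ?_, hp.2.2⟩
    · refine Fin.cases ?_ (fun i => ?_) i
      · exact hp.1
      · exact (hp.2.1 i).2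
    · rintro ⟨i, hi⟩
      exact (hp.2.1 i).1 hi
  · intro x _
    exact Fin.cons_self_tail x
  · rintro ⟨v, y⟩ _
    simp
  · intro x _
    rw [Fin.cons_self_tail]

lemma card_le_sup_id {U : Finset ℕ} {K : ℕ} (hU : U ⊆ Finset.Icc 1 K) : U.card ≤ U.sup id := by
  have : U ⊆ Finset.Icc 1 (U.sup id) := fun u hu =>
    Finset.mem_Icc.2 ⟨(Finset.mem_Icc.1 (hU hu)).1, Finset.le_sup (f := id) hu⟩
  simpa using Finset.card_le_card this

/-- The number of unused elements below the maximum. -/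
lemma card_filter_lt_sup_le {U : Finset ℕ} {K : ℕ} (hU : U ⊆ Finset.Icc 1 K) :
    ((Finset.Icc 1 K \ U).filter (· < U.sup id)).card ≤ U.sup id - U.card := by
  have hsub : U ⊆ Finset.Icc 1 (U.sup id) := fun u hu =>
    Finset.mem_Icc.2 ⟨(Finset.mem_Icc.1 (hU hu)).1, Finset.le_sup (f := id) hu⟩
  calc _ ≤ (Finset.Icc 1 (U.sup id) \ U).card := by
        refine Finset.card_le_card fun v hv => ?_
        simp only [Finset.mem_filter, Finset.mem_sdiff, Finset.mem_Icc] at hv ⊢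
        exact ⟨⟨hv.1.1.1, hv.2.le⟩, hv.1.2⟩
    _ = _ := by rw [Finset.card_sdiff_of_subset hsub, Nat.card_Icc, Nat.add_sub_cancel]

lemma sup_id_mem {U : Finset ℕ} (hne : U.Nonempty) : U.sup id ∈ U := by
  obtain ⟨u, hu, h⟩ := Finset.exists_mem_eq_sup U hne id
  rw [h]; exact hu

lemma union_image_cons {n : ℕ} (U : Finset ℕ) (v : ℕ) (y : Fin n → ℕ) :
    U ∪ Finset.univ.image (Fin.cons v y : Fin (n + 1) → ℕ)
      = insert v U ∪ Finset.univ.image y := by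
  ext a
  simp only [Finset.mem_union, Finset.mem_image, Finset.mem_univ, true_and, Finset.mem_insert,
    Fin.exists_fin_succ, Fin.cons_zero, Fin.cons_succ]
  tauto

/-- The weight of the continuations without a further record. -/
lemma sum_no_record_le (K n : ℕ) (U : Finset ℕ) (hU : U ⊆ Finset.Icc 1 K) (hne : U.Nonempty) :
    ∑ y ∈ injSeqs n (Finset.Icc 1 K \ U),
        (if U.sup id = (U ∪ Finset.univ.image y).sup id then
          setWeight (U.card + n) ((U ∪ Finset.univ.image y).sup id) else 0)
      ≤ U.card / (U.card + n) * setWeight U.card (U.sup id) := by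
  induction n generalizing U with
  | zero =>
    have hpos : (0 : ℝ) < U.card := by exact_mod_cast hne.card_pos
    have huniq : injSeqs 0 (Finset.Icc 1 K \ U) = {Fin.elim0} := by
      ext y
      simp [mem_injSeqs, Function.Injective, Subsingleton.elim y Fin.elim0]
    rw [huniq, Finset.sum_singleton]
    simp [hpos.ne']
  | succ n ih =>
    have hpos : 0 < U.card := hne.card_pos
    rw [sum_injSeqs_succ]
    -- The first arrival must stay below the maximum, as `v ∉ U` excludes equality. This costs a
    -- factor `k / (k + 1)` with `k = U.card`, and the product over the rounds telescopes to `k / (k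
    -- + n)`.
    have hterm : ∀ v ∈ Finset.Icc 1 K \ U,
        ∑ y ∈ injSeqs n ((Finset.Icc 1 K \ U).erase v),
          (if U.sup id = (U ∪ Finset.univ.image (Fin.cons v y : Fin (n + 1) → ℕ)).sup id then
            setWeight (U.card + (n + 1))
              ((U ∪ Finset.univ.image (Fin.cons v y : Fin (n + 1) → ℕ)).sup id) else 0)
        ≤ if v < U.sup id then
            ((U.card + 1 : ℝ) / (U.card + 1 + n)) * setWeight (U.card + 1) (U.sup id) else 0 := by
      intro v hv
      rw [Finset.mem_sdiff] at hv
      have hcard : (insert v U).card = U.card + 1 := Finset.card_insert_of_notMem hv.2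
      simp only [union_image_cons, ← Finset.sdiff_insert]
      split_ifs with hlt
      · have hsup : (insert v U).sup id = U.sup id := by
          rw [Finset.sup_insert]; exact max_eq_right hlt.le
        have := ih (insert v U) (Finset.insert_subset hv.1 hU) (Finset.insert_nonempty _ _)
        rw [hcard, hsup] at this
        push_cast at this
        rw [show U.card + (n + 1) = U.card + 1 + n by ring]
        exact this
      · refine (Finset.sum_eq_zero fun y _ => if_neg fun heq => ?_).le
        have h1 : v ≤ (insert v U ∪ Finset.univ.image y).sup id :=
          Finset.le_sup (f := id) (by simp)
        have h2 : v = U.sup id := le_antisymm (heq ▸ h1) (not_lt.1 hlt)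
        exact hv.2 (h2 ▸ sup_id_mem hne)
    refine (Finset.sum_le_sum hterm).trans ?_
    rw [← Finset.sum_filter, Finset.sum_const, nsmul_eq_mul]
    have h1 := setWeight_nonneg (U.card + 1) (U.sup id)
    have h2 : (((Finset.Icc 1 K \ U).filter (· < U.sup id)).card : ℝ)
        ≤ ((U.sup id - U.card : ℕ) : ℝ) := by exact_mod_cast card_filter_lt_sup_le hU
    have h3 := mul_setWeight_succ_le hpos (U.sup id)
    have h4 : (0 : ℝ) ≤ (U.card + 1 : ℝ) / (U.card + 1 + n) := by positivity
    calc _ ≤ ((U.card + 1 : ℝ) / (U.card + 1 + n)) *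
          (((U.sup id - U.card : ℕ) : ℝ) * setWeight (U.card + 1) (U.sup id)) := by
          rw [mul_left_comm]
          gcongr
      _ ≤ ((U.card + 1 : ℝ) / (U.card + 1 + n)) *
          (U.card / (U.card + 1) * setWeight U.card (U.sup id)) := by gcongr
      _ = _ := by
          have : (0 : ℝ) < U.card := by exact_mod_cast hpos
          push_cast
          field_simp
          ring

/-! ### Stopping rules -/

/-- The rule `b` accepts the element of round `j`, and no earlier one. -/
def RuleStopsAt {n : ℕ} (b : Fin n → (Fin n → ℕ) → Prop) (x : Fin n → ℕ) (j : Fin n) : Prop :=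
  b j x ∧ ∀ i, i < j → ¬ b i x

/-- The decision of round `j` depends only on the elements up to this round. -/
def IsAdapted {n : ℕ} (b : Fin n → (Fin n → ℕ) → Prop) : Prop :=
  ∀ j x y, (∀ i, i ≤ j → x i = y i) → (b j x ↔ b j y)

/-- The rule `b` accepts the maximum of `U` and all elements of the sequence. -/
def Wins {n : ℕ} (U : Finset ℕ) (b : Fin n → (Fin n → ℕ) → Prop) (x : Fin n → ℕ) : Prop :=
  ∃ j, RuleStopsAt b x j ∧ x j = (U ∪ Finset.univ.image x).sup id

lemma wins_cons_of_accept {n : ℕ} {U : Finset ℕ} {b : Fin (n + 1) → (Fin (n + 1) → ℕ) → Prop}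
    {v : ℕ} {y : Fin n → ℕ} (hb : b 0 (Fin.cons v y)) :
    Wins U b (Fin.cons v y) ↔ v = (insert v U ∪ Finset.univ.image y).sup id := by
  unfold Wins RuleStopsAt
  rw [union_image_cons]
  constructor
  · rintro ⟨j, ⟨-, hj⟩, hx⟩
    rcases Fin.eq_zero_or_eq_succ j with rfl | ⟨i, rfl⟩
    · simpa using hx
    · exact absurd hb (hj 0 (Fin.succ_pos i))
  · intro h
    exact ⟨0, ⟨hb, fun i hi => absurd hi (Fin.not_lt_zero i)⟩, by simpa using h⟩

lemma wins_cons_of_reject {n : ℕ} {U : Finset ℕ} {b : Fin (n + 1) → (Fin (n + 1) → ℕ) → Prop}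
    {v : ℕ} {y : Fin n → ℕ} (hb : ¬ b 0 (Fin.cons v y)) :
    Wins U b (Fin.cons v y) ↔ Wins (insert v U) (fun j z => b j.succ (Fin.cons v z)) y := by
  unfold Wins RuleStopsAt
  rw [union_image_cons, Fin.exists_fin_succ]
  simp only [hb, false_and, false_or, Fin.cons_succ]
  refine exists_congr fun j => and_congr_left fun _ => and_congr_right fun _ => ?_
  rw [Fin.forall_fin_succ]
  simp [hb]

lemma IsAdapted.cons {n : ℕ} {b : Fin (n + 1) → (Fin (n + 1) → ℕ) → Prop} (hb : IsAdapted b)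
    (v : ℕ) : IsAdapted fun (j : Fin n) z => b j.succ (Fin.cons v z) := by
  intro j x y hxy
  refine hb _ _ _ fun i hi => ?_
  rcases Fin.eq_zero_or_eq_succ i with rfl | ⟨i, rfl⟩
  · simp
  · simpa using hxy i (Fin.succ_le_succ_iff.1 hi)

open scoped Classical in
/-- The total weight of the continuations of the set `U` with which the rule `b` wins. -/
noncomputable def winWeight (K n : ℕ) (U : Finset ℕ) (b : Fin n → (Fin n → ℕ) → Prop) : ℝ :=
  ∑ x ∈ injSeqs n (Finset.Icc 1 K \ U),
    if Wins U b x then setWeight (U.card + n) ((U ∪ Finset.univ.image x).sup id) else 0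

/-- One step of dynamic programming. Accepting a non-record never wins, accepting a record wins if
no further record follows, and rejecting adds `v` to the history. -/
lemma winWeight_succ_le {K n : ℕ} {U : Finset ℕ} (hU : U ⊆ Finset.Icc 1 K)
    {b : Fin (n + 1) → (Fin (n + 1) → ℕ) → Prop} (hb : IsAdapted b) {β : ℝ} (hβ : 0 ≤ β)
    (h : ∀ v ∈ Finset.Icc 1 K \ U, winWeight K n (insert v U) (fun j z => b j.succ (Fin.cons v z))
      ≤ β * setWeight (U.card + 1) ((insert v U).sup id)) :
    winWeight K (n + 1) U b
      ≤ ∑ v ∈ Finset.Icc 1 K \ U, if v < U.sup id then β * setWeight (U.card + 1) (U.sup id)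
        else max ((U.card + 1 : ℝ) / (U.card + 1 + n)) β * setWeight (U.card + 1) v := by
  classical
  unfold winWeight
  rw [sum_injSeqs_succ]
  refine Finset.sum_le_sum fun v hv => ?_
  have hcard : (insert v U).card = U.card + 1 :=
    Finset.card_insert_of_notMem (Finset.mem_sdiff.1 hv).2
  have hins : insert v U ⊆ Finset.Icc 1 K := Finset.insert_subset (Finset.mem_sdiff.1 hv).1 hU
  simp only [union_image_cons, ← Finset.sdiff_insert]
  -- The tail `0` is arbitrary: by adaptedness the first decision depends on `v` alone.
  by_cases hacc : b 0 (Fin.cons v 0)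
  · have hacc' : ∀ y : Fin n → ℕ, b 0 (Fin.cons v y) := fun y =>
      (hb 0 _ _ fun i hi => by rw [Fin.le_zero_iff.1 hi]; simp).1 hacc
    simp only [fun y => wins_cons_of_accept (U := U) (hacc' y)]
    split_ifs with hlt
    · refine (Finset.sum_nonpos fun y _ => ?_).trans (mul_nonneg hβ (setWeight_nonneg _ _))
      refine (if_neg fun heq => ?_).le
      have : U.sup id ≤ (insert v U ∪ Finset.univ.image y).sup id := by
        refine Finset.sup_mono fun u hu => ?_
        simp [hu]
      omega
    · have hsup : (insert v U).sup id = v := by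
        rw [Finset.sup_insert]; exact max_eq_left (not_lt.1 hlt)
      have := sum_no_record_le K n (insert v U) hins (Finset.insert_nonempty _ _)
      rw [hcard, hsup] at this
      rw [show U.card + (n + 1) = U.card + 1 + n by ring]
      push_cast at this
      refine this.trans ?_
      have := setWeight_nonneg (U.card + 1) v
      gcongr
      exact le_max_left _ _
  · have hacc' : ∀ y : Fin n → ℕ, ¬ b 0 (Fin.cons v y) := fun y hy =>
      hacc ((hb 0 _ _ fun i hi => by rw [Fin.le_zero_iff.1 hi]; simp).1 hy)
    simp only [fun y => wins_cons_of_reject (U := U) (hacc' y)]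
    have := h v hv
    unfold winWeight at this
    rw [hcard] at this
    rw [show U.card + (n + 1) = U.card + 1 + n by ring]
    refine this.trans ?_
    split_ifs with hlt
    · have hsup : (insert v U).sup id = U.sup id := by
        rw [Finset.sup_insert]; exact max_eq_right hlt.le
      rw [hsup]
    · have hsup : (insert v U).sup id = v := by
        rw [Finset.sup_insert]; exact max_eq_left (not_lt.1 hlt)
      rw [hsup]
      have := setWeight_nonneg (U.card + 1) v
      gcongr
      exact le_max_right _ _

/-! ### Backward induction -/

/-- An upper bound for the optimal winning probabilities in the secretary problem with `N`
candidates, by backward induction on the number `k` of candidates seen so far. -/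
structure IsValueBound (N : ℕ) (B : ℕ → ℝ) : Prop where
  nonneg : ∀ k, k ≤ N → 0 ≤ B k
  anti : ∀ k, k < N → B (k + 1) ≤ B k
  step : ∀ k, k < N → 1 / N + k / (k + 1) * B (k + 1) ≤ B k

/-- The Bellman inequality: `step` covers accepting a record, `anti` covers rejecting it. -/
lemma IsValueBound.max_le {N : ℕ} {B : ℕ → ℝ} (hB : IsValueBound N B) {k : ℕ} (hk : k < N) :
    k / (k + 1) * B (k + 1) + max ((k + 1 : ℝ) / N) (B (k + 1)) / (k + 1) ≤ B k := by
  rcases max_cases ((k + 1 : ℝ) / N) (B (k + 1)) with ⟨h, -⟩ | ⟨h, -⟩ <;> rw [h]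
  · refine le_trans (le_of_eq ?_) (hB.step k hk)
    field_simp
    ring
  · refine le_trans (le_of_eq ?_) (hB.anti k hk)
    field_simp

lemma winWeight_le {N : ℕ} {B : ℕ → ℝ} (hB : IsValueBound N B) (K n : ℕ) (U : Finset ℕ)
    (hU : U ⊆ Finset.Icc 1 K) (hne : U.Nonempty) (hN : U.card + n = N)
    (b : Fin n → (Fin n → ℕ) → Prop) (hb : IsAdapted b) :
    winWeight K n U b ≤ B U.card * setWeight U.card (U.sup id) := by
  induction n generalizing U with
  | zero =>
    refine (Finset.sum_nonpos fun x _ => (if_neg ?_).le).trans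
      (mul_nonneg (hB.nonneg _ (by omega)) (setWeight_nonneg _ _))
    rintro ⟨j, -⟩
    exact j.elim0
  | succ n ih =>
    have hpos : 0 < U.card := hne.card_pos
    have hβ := hB.nonneg (U.card + 1) (by omega)
    refine (winWeight_succ_le hU hb hβ fun v hv => ?_).trans ?_
    · have hcard : (insert v U).card = U.card + 1 :=
        Finset.card_insert_of_notMem (Finset.mem_sdiff.1 hv).2
      have := ih (insert v U) (Finset.insert_subset (Finset.mem_sdiff.1 hv).1 hU)
        (Finset.insert_nonempty _ _) (by omega) _ (hb.cons v)
      rwa [hcard] at this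
    · have hNr : (U.card : ℝ) + 1 + n = N := by rw [← hN]; push_cast; ring
      rw [hNr, Finset.sum_ite, Finset.sum_const, nsmul_eq_mul, ← Finset.mul_sum]
      set k := U.card with hk
      set m := U.sup id with hm
      set M := max ((k + 1 : ℝ) / N) (B (k + 1)) with hM
      have hM0 : 0 ≤ M := hβ.trans (le_max_right _ _)
      have hg := setWeight_nonneg k m
      have h1 : (((Finset.Icc 1 K \ U).filter (· < m)).card : ℝ) * (B (k + 1) * setWeight (k + 1) m)
          ≤ k / (k + 1) * B (k + 1) * setWeight k m := by
        have h2 : (((Finset.Icc 1 K \ U).filter (· < m)).card : ℝ) ≤ ((m - k : ℕ) : ℝ) := by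
          exact_mod_cast card_filter_lt_sup_le hU
        have h3 := mul_setWeight_succ_le hpos m
        have h4 := setWeight_nonneg (k + 1) m
        calc _ ≤ B (k + 1) * (((m - k : ℕ) : ℝ) * setWeight (k + 1) m) := by
              rw [mul_left_comm]; gcongr
          _ ≤ B (k + 1) * (k / (k + 1) * setWeight k m) := by gcongr
          _ = _ := by ring
      have h5 : ∑ v ∈ (Finset.Icc 1 K \ U).filter (¬ · < m), setWeight (k + 1) v
          ≤ setWeight k m / (k + 1) := by
        refine le_trans (Finset.sum_le_sum_of_subset_of_nonneg (fun v hv => ?_)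
          fun v _ _ => setWeight_nonneg _ _) (sum_setWeight_succ_le hpos (card_le_sup_id hU) K)
        simp only [Finset.mem_filter, Finset.mem_sdiff, Finset.mem_Icc, Finset.mem_Ioc,
          not_lt] at hv ⊢
        refine ⟨lt_of_le_of_ne hv.2 fun h => hv.1.2 (h ▸ sup_id_mem hne), hv.1.1.2⟩
      calc _ ≤ k / (k + 1) * B (k + 1) * setWeight k m + M * (setWeight k m / (k + 1)) := by
            gcongr
        _ = (k / (k + 1) * B (k + 1) + M / (k + 1)) * setWeight k m := by ring
        _ ≤ B k * setWeight k m := by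
            gcongr
            exact hB.max_le (by omega)

/-- The empty history is separate because `setWeight 0 _ = 0` by division by zero. Its first arrival
is always a record, of weight `setWeight 1 v = 1 / v`. -/
lemma winWeight_empty_le {N : ℕ} {B : ℕ → ℝ} (hB : IsValueBound N B) (hN : 1 ≤ N) (K : ℕ)
    (b : Fin N → (Fin N → ℕ) → Prop) (hb : IsAdapted b) :
    winWeight K N ∅ b ≤ B 0 * ∑ m ∈ Finset.Icc 1 K, (1 / m : ℝ) := by
  obtain ⟨n, rfl⟩ := Nat.exists_eq_add_of_le' hN
  refine (winWeight_succ_le (Finset.empty_subset _) hb (hB.nonneg 1 (by omega))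
    fun v hv => ?_).trans ?_
  · refine winWeight_le hB K n _ (Finset.insert_subset (Finset.mem_sdiff.1 hv).1
      (Finset.empty_subset _)) (Finset.insert_nonempty _ _) ?_ _ (hb.cons v)
    rw [Finset.card_insert_of_notMem (Finset.notMem_empty _), Finset.card_empty]; ring
  · rw [Finset.mul_sum, Finset.sdiff_empty]
    refine Finset.sum_le_sum fun v hv => ?_
    have hmax := hB.max_le (k := 0) (by omega)
    simp only [Finset.card_empty, Finset.sup_empty, Nat.bot_eq_zero, not_lt_zero, if_false]
    push_cast at hmax ⊢
    have : setWeight 1 v = 1 / v := by simp [setWeight]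
    rw [zero_add, this]
    gcongr
    simpa [add_comm] using hmax

/-! ### The explicit value bound -/

/-- The upper bound `1 / N + max_{t ≥ k / N} t * log (1 / t)` for the winning probability. -/
noncomputable def secretaryBound (N k : ℕ) : ℝ :=
  1 / N + if (k : ℝ) / N ≤ 1 / Real.exp 1 then 1 / Real.exp 1 else k / N * Real.log (N / k)

lemma mul_log_inv_le {t : ℝ} (ht : 0 < t) : t * Real.log (1 / t) ≤ 1 / Real.exp 1 := by
  have h1 := Real.add_one_le_exp (Real.log (1 / t) - 1)
  rw [Real.exp_sub, Real.exp_log (by positivity)] at h1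
  have h2 : Real.log (1 / t) ≤ 1 / t / Real.exp 1 := by linarith
  calc t * Real.log (1 / t) ≤ t * (1 / t / Real.exp 1) := by gcongr
    _ = _ := by field_simp

/-- Beyond `1 / e` both recursions follow from `1 / (k + 1) ≤ log ((k + 1) / k)`; the plateau is the
maximum of `t * log (1 / t)`. The summand `1 / N` absorbs the discretization. -/
lemma isValueBound_secretaryBound (N : ℕ) : IsValueBound N (secretaryBound N) := by
  have he : (0 : ℝ) < 1 / Real.exp 1 := by positivity
  have hlog : ∀ k : ℕ, 0 < k → k < N →
      Real.log (N / k) = Real.log (N / (k + 1)) + Real.log ((k + 1) / k) ∧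
      1 / (k + 1 : ℝ) ≤ Real.log ((k + 1) / k) := by
    intro k hk hkN
    have hk' : (0 : ℝ) < k := by exact_mod_cast hk
    have hN' : (0 : ℝ) < N := by exact_mod_cast hk.trans hkN
    constructor
    · rw [← Real.log_mul (by positivity) (by positivity)]
      congr 1
      field_simp
    · have := Real.one_sub_inv_le_log_of_pos (x := ((k : ℝ) + 1) / k) (by positivity)
      refine le_trans (le_of_eq ?_) this
      field_simp
      ring
  have hle : ∀ k : ℕ, 0 < k → k ≤ N → (k : ℝ) / N * Real.log (N / k) ≤ 1 / Real.exp 1 := by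
    intro k hk hkN
    have hk' : (0 : ℝ) < k := by exact_mod_cast hk
    have hN' : (0 : ℝ) < N := by exact_mod_cast hk.trans_le hkN
    have := mul_log_inv_le (t := (k : ℝ) / N) (by positivity)
    rwa [one_div_div] at this
  have hpos : ∀ {k : ℕ}, ¬ (k : ℝ) / N ≤ 1 / Real.exp 1 → 0 < k := fun {k} h => by
    rcases Nat.eq_zero_or_pos k with rfl | hk
    · exact absurd (by simpa using he.le) h
    · exact hk
  have hmono : ∀ k : ℕ, (k : ℝ) / N ≤ ((k + 1 : ℕ) : ℝ) / N := fun k => by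
    push_cast; gcongr; linarith
  refine ⟨fun k hk => ?_, fun k hk => ?_, fun k hk => ?_⟩
  · unfold secretaryBound
    have : (0 : ℝ) ≤ 1 / N := by positivity
    split_ifs with h
    · positivity
    · have hk0 := hpos h
      have : 0 ≤ Real.log (N / k) := Real.log_nonneg (by
        rw [one_le_div (by exact_mod_cast hk0)]; exact_mod_cast hk)
      positivity
  · unfold secretaryBound
    gcongr 1 / (N : ℝ) + ?_
    split_ifs with h1 h2 h2
    · exact le_rfl
    · exact absurd ((hmono k).trans h1) h2
    · exact hle _ (by omega) hk
    · have hk0 := hpos h2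
      have hk' : (0 : ℝ) < k := by exact_mod_cast hk0
      have hN' : (0 : ℝ) < N := by exact_mod_cast hk0.trans hk
      obtain ⟨e1, e2⟩ := hlog k hk0 hk
      -- This is where `k / N > 1 / e` enters: there `t * log (1 / t)` is decreasing.
      have h3 : Real.log (N / k) ≤ 1 := by
        rw [Real.log_le_iff_le_exp (by positivity)]
        rw [not_le, div_lt_div_iff₀ (by positivity) hN'] at h2
        rw [div_le_iff₀ hk']
        linarith
      rw [div_mul_eq_mul_div, div_mul_eq_mul_div]
      gcongr ?_ / _
      push_cast
      rw [e1] at h3 ⊢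
      have h4 : 1 ≤ (k + 1 : ℝ) * Real.log ((k + 1) / k) := by
        rwa [div_le_iff₀' (by positivity)] at e2
      linarith
  · unfold secretaryBound
    gcongr 1 / (N : ℝ) + ?_
    have hN' : (0 : ℝ) < N := by exact_mod_cast (Nat.zero_le k).trans_lt hk
    have hstep : 0 < k → (k : ℝ) / (k + 1) * (1 / N + ((k + 1 : ℕ) : ℝ) / N *
        Real.log (N / (k + 1 : ℕ))) ≤ k / N * Real.log (N / k) := by
      intro hk0
      obtain ⟨e1, e2⟩ := hlog k hk0 hk
      push_cast
      calc (k : ℝ) / (k + 1) * (1 / N + (k + 1) / N * Real.log (N / (k + 1)))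
          = k / N * (Real.log (N / (k + 1)) + 1 / (k + 1)) := by
            field_simp
            ring
        _ ≤ k / N * Real.log (N / k) := by
            rw [e1]
            gcongr
    split_ifs with h1 h2 h2
    · calc (k : ℝ) / (k + 1) * (1 / N + 1 / Real.exp 1)
          = (k / N + k * (1 / Real.exp 1)) / (k + 1) := by ring
        _ ≤ (1 / Real.exp 1 + k * (1 / Real.exp 1)) / (k + 1) := by gcongr
        _ = 1 / Real.exp 1 := by field_simp; ring
    · exact absurd ((hmono k).trans h1) h2
    · rcases Nat.eq_zero_or_pos k with rfl | hk0
      · simpa using he.le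
      · exact (hstep hk0).trans (hle k hk0 hk.le)
    · exact hstep (hpos h2)

/-! ### Expectations as sums over sequences -/

lemma sum_equiv_map {n : ℕ} (e : ℕ ↪ ℝ≥0) (D : Finset ℕ) (hD : D.card = n)
    (F : (Fin n → ℝ≥0) → ℝ) :
    ∑ σ : Fin n ≃ ↥(D.map e), F (fun i => (σ i : ℝ≥0))
      = ∑ x ∈ injSeqs n D, F (fun i => e (x i)) := by
  have hinv : ∀ d : ↥(D.map e), Function.invFun e d ∈ D ∧ e (Function.invFun e d) = d := by
    rintro ⟨d, hd⟩
    obtain ⟨a, ha, rfl⟩ := Finset.mem_map.1 hd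
    simp only [Function.leftInverse_invFun e.injective a]
    exact ⟨ha, trivial⟩
  refine Finset.sum_bij (fun σ _ i => Function.invFun e (σ i)) ?_ ?_ ?_ ?_
  · intro σ _
    refine mem_injSeqs.2 ⟨fun i => (hinv _).1, fun i j hij => σ.injective (Subtype.ext ?_)⟩
    rw [← (hinv (σ i)).2, ← (hinv (σ j)).2]
    exact congrArg e hij
  · intro σ _ τ _ h
    ext i
    rw [← (hinv (σ i)).2, ← (hinv (τ i)).2]
    exact congrArg (fun f => (e f : ℝ)) (congrFun h i)
  · intro x hx
    rw [mem_injSeqs] at hx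
    have hbij : Function.Bijective
        fun i => (⟨e (x i), Finset.mem_map_of_mem e (hx.1 i)⟩ : ↥(D.map e)) := by
      rw [Fintype.bijective_iff_injective_and_card]
      refine ⟨fun i j hij => hx.2 (e.injective (congrArg Subtype.val hij)), ?_⟩
      simp [hD]
    refine ⟨Equiv.ofBijective _ hbij, Finset.mem_univ _, ?_⟩
    funext i
    exact Function.leftInverse_invFun e.injective (x i)
  · intro σ _
    congr 1
    funext i
    exact (hinv (σ i)).2.symm

/-- Double counting: `H` and `x` determine `C`. The history can thus be drawn before the rest of
`C`, as the player sees it. -/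
lemma sum_powersetCard_injSeqs (n h : ℕ) (V : Finset ℕ)
    (f : Finset ℕ → Finset ℕ → (Fin n → ℕ) → ℝ) :
    ∑ C ∈ V.powersetCard (n + h), ∑ H ∈ C.powersetCard h, ∑ x ∈ injSeqs n (C \ H), f C H x
      = ∑ H ∈ V.powersetCard h, ∑ x ∈ injSeqs n (V \ H),
          f (H ∪ Finset.univ.image x) H x := by
  rw [Finset.sum_comm' (t' := V.powersetCard h)
    (s' := fun H => (V.powersetCard (n + h)).filter (H ⊆ ·))]
  · refine Finset.sum_congr rfl fun H hH => ?_
    rw [Finset.mem_powersetCard] at hH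
    rw [Finset.sum_comm' (t' := injSeqs n (V \ H))
      (s' := fun x => {H ∪ Finset.univ.image x})]
    · exact Finset.sum_congr rfl fun x _ => Finset.sum_singleton _ _
    · intro C x
      simp only [Finset.mem_filter, Finset.mem_powersetCard, mem_injSeqs, Finset.mem_singleton,
        Finset.mem_sdiff]
      have hcard : (∀ i, x i ∉ H) → Function.Injective x →
          (H ∪ Finset.univ.image x).card = n + h := fun h1 h2 => by
        rw [Finset.card_union_of_disjoint, Finset.card_image_of_injective _ h2, hH.2,
          Finset.card_univ, Fintype.card_fin, add_comm]
        rw [Finset.disjoint_right]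
        intro a ha
        obtain ⟨i, -, rfl⟩ := Finset.mem_image.1 ha
        exact h1 i
      constructor
      · rintro ⟨⟨⟨hCV, hC⟩, hHC⟩, hx, hinj⟩
        refine ⟨(Finset.eq_of_subset_of_card_le ?_ ?_).symm, fun i => ⟨hCV (hx i).1, (hx i).2⟩, hinj⟩
        · refine Finset.union_subset hHC fun a ha => ?_
          obtain ⟨i, -, rfl⟩ := Finset.mem_image.1 ha
          exact (hx i).1
        · rw [hC, hcard (fun i => (hx i).2) hinj]
      · rintro ⟨rfl, hx, hinj⟩
        refine ⟨⟨⟨Finset.union_subset hH.1 fun a ha => ?_, hcard (fun i => (hx i).2) hinj⟩,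
          Finset.subset_union_left⟩, fun i => ⟨by simp, (hx i).2⟩, hinj⟩
        obtain ⟨i, -, rfl⟩ := Finset.mem_image.1 ha
        exact (hx i).1
  · intro C H
    simp only [Finset.mem_filter, Finset.mem_powersetCard]
    constructor
    · rintro ⟨⟨h1, h2⟩, h3, h4⟩
      exact ⟨⟨⟨h1, h2⟩, h3⟩, h3.trans h1, h4⟩
    · rintro ⟨⟨⟨h1, h2⟩, h3⟩, -, h4⟩
      exact ⟨⟨h1, h2⟩, h3, h4⟩

lemma union_image_of_mem_injSeqs {n h : ℕ} {C H : Finset ℕ} {x : Fin n → ℕ}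
    (hC : C.card = n + h) (hH : H ∈ C.powersetCard h) (hx : x ∈ injSeqs n (C \ H)) :
    H ∪ Finset.univ.image x = C := by
  rw [Finset.mem_powersetCard] at hH
  rw [mem_injSeqs] at hx
  have hsub : Finset.univ.image x ⊆ C \ H := fun a ha => by
    obtain ⟨i, -, rfl⟩ := Finset.mem_image.1 ha
    exact hx.1 i
  rw [Finset.eq_of_subset_of_card_le hsub, Finset.union_sdiff_of_subset hH.1]
  rw [Finset.card_sdiff_of_subset hH.1, Finset.card_image_of_injective _ hx.2, hC, hH.2]
  simp

lemma expectedValue_map {n h : ℕ} {Ω : Type*} [MeasurableSpace Ω] (A : OnlineAlgorithm n Ω)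
    (μ : Measure Ω) (e : ℕ ↪ ℝ≥0) (C : Finset ℕ) (hC : C.card = n + h) :
    A.expectedValue μ h (C.map e) = (∑ H ∈ C.powersetCard h, ∑ x ∈ injSeqs n (C \ H),
      ∫ ω, A.payoff ω (H.map e) (fun i => e (x i)) ∂μ) / (n + h).factorial * h.factorial := by
  have hinner : ∀ H ∈ C.powersetCard h,
      (𝔼 σ : Fin n ≃ ↥(C.map e \ H.map e),
        ∫ ω, A.payoff ω (H.map e) (fun i => (σ i : ℝ≥0)) ∂μ)
      = (∑ x ∈ injSeqs n (C \ H), ∫ ω, A.payoff ω (H.map e) (fun i => e (x i)) ∂μ)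
        / n.factorial := by
    intro H hH
    rw [Finset.mem_powersetCard] at hH
    have hD : (C \ H).card = n := by
      rw [Finset.card_sdiff_of_subset hH.1, hC, hH.2]; omega
    rw [← Finset.map_sdiff, Fintype.expect_eq_sum_div_card,
      sum_equiv_map e (C \ H) hD (fun y => ∫ ω, A.payoff ω (H.map e) y ∂μ)]
    congr 2
    have e1 : Fin n ≃ ↥((C \ H).map e) := (Fintype.equivFinOfCardEq (by simp [hD])).symm
    rw [Fintype.card_equiv e1, Fintype.card_fin]
  unfold OnlineAlgorithm.expectedValue
  rw [Finset.expect_eq_sum_div_card, Finset.powersetCard_map, Finset.sum_map, Finset.card_map,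
    Finset.card_powersetCard, hC]
  refine (congrArg (· / (((n + h).choose h : ℕ) : ℝ)) (Finset.sum_congr rfl hinner)).trans ?_
  rw [← Finset.sum_div]
  have h1 : (((n + h).choose h : ℕ) : ℝ) * h.factorial * n.factorial = (n + h).factorial := by
    have := Nat.choose_mul_factorial_mul_factorial (Nat.le_add_left h n)
    rw [Nat.add_sub_cancel] at this
    exact_mod_cast this
  have h2 : (0 : ℝ) < ((n + h).choose h : ℕ) := by
    exact_mod_cast Nat.choose_pos (Nat.le_add_left h n)
  have h3 : (0 : ℝ) < n.factorial := by positivity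
  have h4 : (0 : ℝ) < h.factorial := by positivity
  rw [← h1]
  field_simp

/-- Only the histories that avoid the maximum of `C` are kept; they form a fraction `n / (n + h)`.
-/
lemma le_expectedOpt_map {n h : ℕ} (hn : 1 ≤ n) (e : ℕ ↪ ℝ≥0) (C : Finset ℕ)
    (hC : C.card = n + h) :
    (n : ℝ) / (n + h) * (e (C.sup id) : ℝ) ≤ expectedOpt h (C.map e) := by
  have hne : C.Nonempty := Finset.card_pos.1 (by omega)
  have hmem := sup_id_mem hne
  set m := C.sup id
  unfold expectedOpt
  rw [Finset.expect_eq_sum_div_card, Finset.powersetCard_map, Finset.sum_map, Finset.card_map,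
    Finset.card_powersetCard, hC]
  simp only [Finset.mapEmbedding_apply, RelEmbedding.coe_toEmbedding]
  have h2 : (0 : ℝ) < ((n + h).choose h : ℕ) := by
    exact_mod_cast Nat.choose_pos (Nat.le_add_left h n)
  have h1 : (((n - 1 + h).choose h : ℕ) : ℝ) * (n + h) = ((n + h).choose h : ℕ) * n := by
    have := Nat.choose_mul_succ_eq (n - 1 + h) h
    rw [show n - 1 + h + 1 = n + h by omega, Nat.add_sub_cancel] at this
    exact_mod_cast this
  have hn' : (0 : ℝ) < n := by exact_mod_cast hn
  rw [le_div_iff₀ h2]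
  calc (n : ℝ) / (n + h) * (e m : ℝ) * ((n + h).choose h : ℕ)
      = ((n - 1 + h).choose h : ℕ) * (e m : ℝ) := by
        field_simp
        linear_combination -(e m : ℝ) * h1
    _ = ∑ H ∈ (C.erase m).powersetCard h, (e m : ℝ) := by
        rw [Finset.sum_const, Finset.card_powersetCard, Finset.card_erase_of_mem hmem, hC,
          nsmul_eq_mul, show n + h - 1 = n - 1 + h by omega]
    _ ≤ ∑ H ∈ (C.erase m).powersetCard h, (((C.map e \ H.map e).sup id : ℝ≥0) : ℝ) := by
        refine Finset.sum_le_sum fun H hH => ?_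
        rw [Finset.mem_powersetCard] at hH
        have hm : m ∉ H := fun h => by simpa using hH.1 h
        rw [← Finset.map_sdiff]
        exact_mod_cast Finset.le_sup (f := id)
          (Finset.mem_map_of_mem e (Finset.mem_sdiff.2 ⟨hmem, hm⟩))
    _ ≤ _ := Finset.sum_le_sum_of_subset_of_nonneg
        (Finset.powersetCard_mono (Finset.erase_subset _ _)) fun H _ _ => NNReal.coe_nonneg _

/-! ### Exponentially spaced values -/

/-- The map `m ↦ M ^ m`. -/
noncomputable def powEmbedding (M : ℕ) (hM : 1 < M) : ℕ ↪ ℝ≥0 :=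
  ⟨fun m => (M : ℝ≥0) ^ m, pow_right_injective₀ (by exact_mod_cast (by omega : 0 < M))
    (by exact_mod_cast hM.ne')⟩

namespace OnlineAlgorithm

variable {n : ℕ} {Ω : Type*} [MeasurableSpace Ω]

/-- The acceptance rule of the algorithm on the candidates `e 0, e 1, …`, with the internal
randomness and the history set fixed. -/
def rule (A : OnlineAlgorithm n Ω) (e : ℕ ↪ ℝ≥0) (ω : Ω) (H : Finset ℕ) (j : Fin n)
    (x : Fin n → ℕ) : Prop :=
  A.accept ω (H.map e) j (seen (fun i => e (x i)) j) = true

lemma isAdapted_rule (A : OnlineAlgorithm n Ω) (e : ℕ ↪ ℝ≥0) (ω : Ω) (H : Finset ℕ) :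
    IsAdapted (A.rule e ω H) := by
  intro j x y hxy
  have : seen (fun i => e (x i)) j = seen (fun i => e (y i)) j := by
    funext i
    exact congrArg e (hxy _ (Fin.le_def.2 (Nat.lt_succ_iff.1 i.isLt)))
  unfold rule
  rw [this]

lemma stopsAt_iff (A : OnlineAlgorithm n Ω) (e : ℕ ↪ ℝ≥0) (ω : Ω) (H : Finset ℕ)
    (x : Fin n → ℕ) (j : Fin n) :
    A.StopsAt ω (H.map e) (fun i => e (x i)) j ↔ RuleStopsAt (A.rule e ω H) x j := by
  simp [StopsAt, RuleStopsAt, rule]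

-- An accepted exponent below the maximum `m` is at most `m - 1`, so a losing choice earns at most
-- `M ^ m / M`.
open scoped Classical in
lemma payoff_le (A : OnlineAlgorithm n Ω) {M : ℕ} (hM : 1 < M) (ω : Ω) (H : Finset ℕ)
    (x : Fin n → ℕ) :
    A.payoff ω (H.map (powEmbedding M hM)) (fun i => powEmbedding M hM (x i))
      ≤ (M : ℝ) ^ (H ∪ Finset.univ.image x).sup id *
        (1 / M + if Wins H (A.rule (powEmbedding M hM) ω H) x then 1 else 0) := by
  set e := powEmbedding M hM
  set m := (H ∪ Finset.univ.image x).sup id with hm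
  have hM1 : (1 : ℝ) < M := by exact_mod_cast hM
  unfold payoff
  simp only [stopsAt_iff]
  by_cases hacc : ∃ j, RuleStopsAt (A.rule e ω H) x j
  · obtain ⟨j, hj⟩ := hacc
    have huniq : ∀ i, RuleStopsAt (A.rule e ω H) x i ↔ i = j := by
      refine fun i => ⟨fun hi => ?_, fun h => h ▸ hj⟩
      rcases lt_trichotomy i j with h | h | h
      · exact absurd hi.1 (hj.2 i h)
      · exact h
      · exact absurd hj.1 (hi.2 j h)
    simp only [huniq, Finset.sum_ite_eq', Finset.mem_univ, if_true]
    have hval : (e (x j) : ℝ) = (M : ℝ) ^ x j := by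
      simp [e, powEmbedding]
    rw [hval]
    have hle : x j ≤ m := Finset.le_sup (f := id) (by simp)
    rcases hle.eq_or_lt with heq | hlt
    · rw [if_pos ⟨j, hj, heq⟩, heq]
      exact le_mul_of_one_le_right (by positivity) (by simp)
    · have h1 : (M : ℝ) ^ (x j + 1) ≤ (M : ℝ) ^ m := pow_le_pow_right₀ hM1.le hlt
      have h2 : (M : ℝ) ^ x j ≤ (M : ℝ) ^ m * (1 / M) := by
        rw [mul_one_div, le_div_iff₀ (by positivity), ← pow_succ]
        exact h1
      refine h2.trans ?_
      gcongr
      split_ifs <;> simp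
  · rw [Finset.sum_eq_zero fun j _ => if_neg fun h => hacc ⟨j, h⟩]
    have : (0 : ℝ) ≤ if Wins H (A.rule e ω H) x then 1 else 0 := by split_ifs <;> simp
    positivity

lemma integrable_payoff (A : OnlineAlgorithm n Ω) (μ : Measure Ω) [IsFiniteMeasure μ]
    (H : Finset ℝ≥0) (x : Fin n → ℝ≥0) : Integrable (fun ω => A.payoff ω H x) μ := by
  classical
  unfold payoff
  refine integrable_finsetSum _ fun j _ => ?_
  have hset : MeasurableSet {ω | A.StopsAt ω H x j} := by
    have : {ω | A.StopsAt ω H x j} = (fun ω => A.accept ω H j (seen x j)) ⁻¹' {true} ∩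
        ⋂ i : Fin n, ⋂ _ : i < j, (fun ω => A.accept ω H i (seen x i)) ⁻¹' {false} := by
      ext ω
      simp [StopsAt]
    rw [this]
    exact (A.measurable_accept _ _ _ (measurableSet_singleton _)).inter
      (MeasurableSet.iInter fun i => MeasurableSet.iInter fun _ =>
        A.measurable_accept _ _ _ (measurableSet_singleton _))
  have := (integrable_const (μ := μ) (x j : ℝ)).indicator hset
  refine this.congr (Filter.Eventually.of_forall fun ω => ?_)
  simp [Set.indicator]

end OnlineAlgorithm

/-! ### Averaging over the instances -/

lemma sum_winWeight_le {n h K : ℕ} (hn : 1 ≤ n) {B : ℕ → ℝ} (hB : IsValueBound (n + h) B)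
    (b : Finset ℕ → Fin n → (Fin n → ℕ) → Prop) (hb : ∀ H, IsAdapted (b H)) :
    h.factorial * ∑ H ∈ (Finset.Icc 1 K).powersetCard h, winWeight K n H (b H)
      ≤ B h * ∑ m ∈ Finset.Icc 1 K, (1 / m : ℝ) := by
  rcases h with _ | h
  · rw [Finset.powersetCard_zero, Finset.sum_singleton]
    simpa using winWeight_empty_le hB hn K (b ∅) (hb ∅)
  · have hB0 := hB.nonneg (h + 1) (by omega)
    calc _ ≤ ((h + 1).factorial : ℝ) * ∑ H ∈ (Finset.Icc 1 K).powersetCard (h + 1),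
          B (h + 1) * setWeight (h + 1) (H.sup id) := by
          gcongr with H hH
          rw [Finset.mem_powersetCard] at hH
          have := winWeight_le hB K n H hH.1 (Finset.card_pos.1 (by omega)) (by omega) (b H) (hb H)
          rwa [hH.2] at this
      _ = B (h + 1) * ∑ m ∈ Finset.Icc (h + 1) K, (1 / m : ℝ) := by
          rw [← Finset.mul_sum, mul_left_comm, sum_powersetCard_setWeight]
      _ ≤ _ := by
          refine mul_le_mul_of_nonneg_left ?_ hB0
          exact Finset.sum_le_sum_of_subset_of_nonneg (Finset.Icc_subset_Icc_left (by omega))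
            fun m _ _ => by positivity

lemma card_injSeqs {n : ℕ} {D : Finset ℕ} (hD : D.card = n) :
    (injSeqs n D).card = n.factorial := by
  have := sum_equiv_map Nat.castEmbedding D hD fun _ => 1
  have e1 : Fin n ≃ ↥(D.map (Nat.castEmbedding : ℕ ↪ ℝ≥0)) :=
    (Fintype.equivFinOfCardEq (by simp [hD])).symm
  simp only [Finset.sum_const, Finset.card_univ, nsmul_eq_mul, mul_one] at this
  rw [Fintype.card_equiv e1, Fintype.card_fin] at this
  exact_mod_cast this.symm

lemma factorial_mul_sum_setWeight {N : ℕ} (hN : 1 ≤ N) (K : ℕ) :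
    (N.factorial : ℝ) * ∑ C ∈ (Finset.Icc 1 K).powersetCard N, setWeight N (C.sup id)
      = ∑ m ∈ Finset.Icc N K, (1 / m : ℝ) := by
  obtain ⟨k, rfl⟩ := Nat.exists_eq_add_of_le' hN
  exact sum_powersetCard_setWeight k K

/-- Division by `M ^ C.sup id` normalizes the best value to `1`, which turns payoff into winning
weight up to an error `1 / M`. -/
lemma sum_weight_payoff_le {n h K M : ℕ} {Ω : Type*} [MeasurableSpace Ω] (hn : 1 ≤ n)
    (hM : 1 < M) (A : OnlineAlgorithm n Ω) {B : ℕ → ℝ} (hB : IsValueBound (n + h) B) (ω : Ω) :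
    h.factorial * ∑ C ∈ (Finset.Icc 1 K).powersetCard (n + h), ∑ H ∈ C.powersetCard h,
        ∑ x ∈ injSeqs n (C \ H), setWeight (n + h) (C.sup id) / (M : ℝ) ^ C.sup id *
          A.payoff ω (H.map (powEmbedding M hM)) (fun i => powEmbedding M hM (x i))
      ≤ (∑ m ∈ Finset.Icc (n + h) K, (1 / m : ℝ)) / M
        + B h * ∑ m ∈ Finset.Icc 1 K, (1 / m : ℝ) := by
  classical
  set e := powEmbedding M hM
  have hM0 : (0 : ℝ) < M := by exact_mod_cast (by omega : 0 < M)
  have hterm : ∀ C ∈ (Finset.Icc 1 K).powersetCard (n + h), ∀ H ∈ C.powersetCard h,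
      ∀ x ∈ injSeqs n (C \ H), setWeight (n + h) (C.sup id) / (M : ℝ) ^ C.sup id *
          A.payoff ω (H.map e) (fun i => e (x i))
        ≤ setWeight (n + h) (C.sup id) / M
          + if Wins H (A.rule e ω H) x then setWeight (n + h) (C.sup id) else 0 := by
    intro C hC H hH x hx
    have h1 := A.payoff_le hM ω H x
    rw [union_image_of_mem_injSeqs (Finset.mem_powersetCard.1 hC).2 hH hx] at h1
    have h2 := setWeight_nonneg (n + h) (C.sup id)
    calc _ ≤ setWeight (n + h) (C.sup id) / (M : ℝ) ^ C.sup id * _ :=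
          mul_le_mul_of_nonneg_left h1 (by positivity)
      _ = _ := by
          split_ifs
          · field_simp
          · rw [add_zero, add_zero]
            field_simp
  have hcount : ∀ C ∈ (Finset.Icc 1 K).powersetCard (n + h),
      ∑ H ∈ C.powersetCard h, ∑ x ∈ injSeqs n (C \ H), setWeight (n + h) (C.sup id) / M
        = ((n + h).choose h * n.factorial : ℕ) * (setWeight (n + h) (C.sup id) / M) := by
    intro C hC
    have hC' := (Finset.mem_powersetCard.1 hC).2
    have : ∀ H ∈ C.powersetCard h,
        ∑ x ∈ injSeqs n (C \ H), setWeight (n + h) (C.sup id) / M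
          = n.factorial * (setWeight (n + h) (C.sup id) / M) := by
      intro H hH
      rw [Finset.mem_powersetCard] at hH
      rw [Finset.sum_const, card_injSeqs, nsmul_eq_mul]
      rw [Finset.card_sdiff_of_subset hH.1, hC', hH.2, Nat.add_sub_cancel]
    rw [Finset.sum_congr rfl this, Finset.sum_const, Finset.card_powersetCard, hC', nsmul_eq_mul]
    push_cast
    ring
  have hfac : (h.factorial : ℝ) * ((n + h).choose h * n.factorial : ℕ) = (n + h).factorial := by
    have := Nat.choose_mul_factorial_mul_factorial (Nat.le_add_left h n)
    rw [Nat.add_sub_cancel] at this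
    rw [← this]
    push_cast
    ring
  have hwin : ∑ H ∈ (Finset.Icc 1 K).powersetCard h, winWeight K n H (A.rule e ω H)
      = ∑ C ∈ (Finset.Icc 1 K).powersetCard (n + h), ∑ H ∈ C.powersetCard h,
        ∑ x ∈ injSeqs n (C \ H),
          if Wins H (A.rule e ω H) x then setWeight (n + h) (C.sup id) else 0 := by
    rw [sum_powersetCard_injSeqs n h (Finset.Icc 1 K) fun C H x =>
      if Wins H (A.rule e ω H) x then setWeight (n + h) (C.sup id) else 0]
    refine Finset.sum_congr rfl fun H hH => ?_
    unfold winWeight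
    rw [(Finset.mem_powersetCard.1 hH).2, add_comm h n]
  calc _ ≤ (h.factorial : ℝ) * ∑ C ∈ (Finset.Icc 1 K).powersetCard (n + h),
        ∑ H ∈ C.powersetCard h, ∑ x ∈ injSeqs n (C \ H),
          (setWeight (n + h) (C.sup id) / M
            + if Wins H (A.rule e ω H) x then setWeight (n + h) (C.sup id) else 0) := by
        refine mul_le_mul_of_nonneg_left ?_ (by positivity)
        exact Finset.sum_le_sum fun C hC => Finset.sum_le_sum fun H hH =>
          Finset.sum_le_sum fun x hx => hterm C hC H hH x hx
    _ = (∑ m ∈ Finset.Icc (n + h) K, (1 / m : ℝ)) / M + h.factorial *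
          ∑ H ∈ (Finset.Icc 1 K).powersetCard h, winWeight K n H (A.rule e ω H) := by
        simp only [Finset.sum_add_distrib]
        rw [← hwin, mul_add, Finset.sum_congr rfl hcount, ← Finset.mul_sum, ← mul_assoc, hfac,
          ← Finset.sum_div, ← factorial_mul_sum_setWeight (by omega), mul_div_assoc]
    _ ≤ _ := add_le_add_right (sum_winWeight_le hn hB _ fun H => A.isAdapted_rule e ω H) _

lemma competitive_le {n h M : ℕ} {Ω : Type*} [MeasurableSpace Ω] (hn : 1 ≤ n)
    (hM : 1 < M) (μ : Measure Ω) [IsProbabilityMeasure μ] (A : OnlineAlgorithm n Ω) {c : ℝ}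
    (hc0 : 0 ≤ c) (hc : A.IsCompetitive μ h c) {B : ℕ → ℝ} (hB : IsValueBound (n + h) B) (K : ℕ) :
    c * (n / (n + h)) * ∑ m ∈ Finset.Icc (n + h) K, (1 / m : ℝ)
      ≤ (∑ m ∈ Finset.Icc (n + h) K, (1 / m : ℝ)) / M
        + B h * ∑ m ∈ Finset.Icc 1 K, (1 / m : ℝ) := by
  set e := powEmbedding M hM with he
  have hM0 : (0 : ℝ) < M := by exact_mod_cast (by omega : 0 < M)
  have hval : ∀ m, (e m : ℝ) = (M : ℝ) ^ m := fun m => by simp [he, powEmbedding]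
  have hint : ∀ (H : Finset ℕ) (x : Fin n → ℕ) (a : ℝ),
      Integrable (fun ω => a * A.payoff ω (H.map e) (fun i => e (x i))) μ :=
    fun H x a => (A.integrable_payoff μ _ _).const_mul a
  have hinner : ∀ (H : Finset ℕ) (S : Finset (Fin n → ℕ)) (a : ℝ),
      ∫ ω, (∑ x ∈ S, a * A.payoff ω (H.map e) (fun i => e (x i))) ∂μ
        = a * ∑ x ∈ S, ∫ ω, A.payoff ω (H.map e) (fun i => e (x i)) ∂μ := by
    intro H S a
    rw [integral_finsetSum _ fun x _ => hint H x a, Finset.mul_sum]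
    exact Finset.sum_congr rfl fun x _ => integral_const_mul _ _
  calc c * (n / (n + h)) * ∑ m ∈ Finset.Icc (n + h) K, (1 / m : ℝ)
      = (n + h).factorial * ∑ C ∈ (Finset.Icc 1 K).powersetCard (n + h),
          setWeight (n + h) (C.sup id) / (M : ℝ) ^ C.sup id *
            (c * (n / (n + h) * (e (C.sup id) : ℝ))) := by
        rw [← factorial_mul_sum_setWeight (by omega), mul_left_comm, Finset.mul_sum]
        congr 1
        refine Finset.sum_congr rfl fun C _ => ?_
        rw [hval]
        field_simp
    _ ≤ (n + h).factorial * ∑ C ∈ (Finset.Icc 1 K).powersetCard (n + h),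
          setWeight (n + h) (C.sup id) / (M : ℝ) ^ C.sup id *
            A.expectedValue μ h (C.map e) := by
        refine mul_le_mul_of_nonneg_left (Finset.sum_le_sum fun C hC => ?_) (by positivity)
        have hC' := (Finset.mem_powersetCard.1 hC).2
        have h1 := setWeight_nonneg (n + h) (C.sup id)
        refine mul_le_mul_of_nonneg_left ?_ (by positivity)
        exact (mul_le_mul_of_nonneg_left (le_expectedOpt_map hn e C hC') hc0).trans
          (hc _ (by rw [Finset.card_map, hC']))
    _ = ∫ ω, (h.factorial * ∑ C ∈ (Finset.Icc 1 K).powersetCard (n + h),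
          ∑ H ∈ C.powersetCard h, ∑ x ∈ injSeqs n (C \ H),
            setWeight (n + h) (C.sup id) / (M : ℝ) ^ C.sup id *
              A.payoff ω (H.map e) (fun i => e (x i))) ∂μ := by
        rw [integral_const_mul, integral_finsetSum _ fun C _ => integrable_finsetSum _ fun H _ =>
          integrable_finsetSum _ fun x _ => hint H x _, Finset.mul_sum, Finset.mul_sum]
        refine Finset.sum_congr rfl fun C hC => ?_
        rw [expectedValue_map A μ e C (Finset.mem_powersetCard.1 hC).2,
          integral_finsetSum _ fun H _ => integrable_finsetSum _ fun x _ => hint H x _]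
        simp only [hinner]
        simp only [← Finset.mul_sum]
        have : (0 : ℝ) < (n + h).factorial := by positivity
        field_simp
    _ ≤ ∫ _, ((∑ m ∈ Finset.Icc (n + h) K, (1 / m : ℝ)) / M
        + B h * ∑ m ∈ Finset.Icc 1 K, (1 / m : ℝ)) ∂μ := by
        refine integral_mono ?_ (integrable_const _) fun ω => sum_weight_payoff_le hn hM A hB ω
        exact (integrable_finsetSum _ fun C _ => integrable_finsetSum _ fun H _ =>
          integrable_finsetSum _ fun x _ => hint H x _).const_mul _
    _ = _ := by simp

/-- Partial sums of the harmonic series are unbounded, so omitting finitely many terms does not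
matter. -/
lemma le_of_mul_harmonic_le {N : ℕ} {a b : ℝ} (hb : 0 ≤ b)
    (h : ∀ K : ℕ, a * ∑ m ∈ Finset.Icc N K, (1 / m : ℝ)
      ≤ b * ∑ m ∈ Finset.Icc 1 K, (1 / m : ℝ)) : a ≤ b := by
  have hsum : ∀ K : ℕ, ∑ m ∈ Finset.Icc 1 K, (1 / m : ℝ)
      = ∑ i ∈ Finset.range K, 1 / ((i : ℝ) + 1) := by
    intro K
    induction K with
    | zero => simp
    | succ K ih =>
      rw [Finset.sum_Icc_succ_top (by omega), Finset.sum_range_succ, ih]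
      push_cast
      rfl
  by_contra! hab
  set s := ∑ m ∈ Finset.range N, (1 / m : ℝ)
  have hdiff : ∀ K : ℕ, ∑ m ∈ Finset.Icc 1 K, (1 / m : ℝ)
      ≤ ∑ m ∈ Finset.Icc N K, (1 / m : ℝ) + s := by
    intro K
    have hsub : Finset.Icc 1 K ⊆ Finset.Icc N K ∪ Finset.range N := fun m hm => by
      simp only [Finset.mem_union, Finset.mem_Icc, Finset.mem_range] at hm ⊢
      omega
    rw [← Finset.sum_union]
    · exact Finset.sum_le_sum_of_subset_of_nonneg hsub fun m _ _ => by positivity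
    · rw [Finset.disjoint_left]
      intro m hm hm'
      simp only [Finset.mem_Icc, Finset.mem_range] at hm hm'
      omega
  -- With `S` the full harmonic sum, `a * (S - s) ≤ b * S` forces `S ≤ a * s / (a - b)`.
  obtain ⟨K, hK⟩ := (Real.tendsto_sum_range_one_div_nat_succ_atTop.eventually_gt_atTop
    (a * s / (a - b))).exists
  rw [← hsum, div_lt_iff₀ (by linarith)] at hK
  have h1 := mul_le_mul_of_nonneg_left (hdiff K) (hb.trans hab.le)
  linarith [h K]

theorem mainTheorem8 (n h : ℕ) (hn : 1 ≤ n) {Ω : Type*} [MeasurableSpace Ω]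
    (μ : Measure Ω) [IsProbabilityMeasure μ] (A : OnlineAlgorithm n Ω) (c : ℝ)
    (hc : A.IsCompetitive μ h c) :
    c ≤ if (h : ℝ) / ((n : ℝ) + h) ≤ 1 / Real.exp 1 then
          1 / Real.exp 1 * (((n : ℝ) + h) / n) + 1 / n
        else
          (h : ℝ) / n * Real.log (((h : ℝ) + n) / h) + 1 / n := by
  have hn' : (0 : ℝ) < n := by exact_mod_cast hn
  have hB := isValueBound_secretaryBound (n + h)
  have hB0 := hB.nonneg h (by omega)
  have key : c * (n / (n + h)) ≤ secretaryBound (n + h) h := by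
    rcases lt_or_ge c 0 with hc0 | hc0
    · exact (mul_nonpos_of_nonpos_of_nonneg hc0.le (by positivity)).trans hB0
    · refine le_of_forall_pos_le_add fun ε hε => ?_
      obtain ⟨M, hM⟩ := exists_nat_one_div_lt hε
      -- The base is `M + 2` because `powEmbedding` needs a base above `1`. The error `1 / (M + 2)`
      -- is moved to the left so that `K → ∞` can be taken at fixed `M`.
      have h1 : c * (n / (n + h)) - 1 / (M + 2 : ℕ) ≤ secretaryBound (n + h) h :=
        le_of_mul_harmonic_le (N := n + h) hB0 fun K => by
          have := competitive_le hn (M := M + 2) (by omega) μ A hc0 hc hB K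
          rw [sub_mul, one_div_mul_eq_div]
          linarith
      have h2 : (1 : ℝ) / (M + 2 : ℕ) ≤ 1 / (M + 1) := by
        push_cast
        gcongr
        norm_num
      linarith
  have hcB : c ≤ ((n : ℝ) + h) / n * secretaryBound (n + h) h := by
    calc c = ((n : ℝ) + h) / n * (c * (n / (n + h))) := by field_simp
      _ ≤ _ := by gcongr
  refine hcB.trans (le_of_eq ?_)
  unfold secretaryBound
  push_cast
  split_ifs with hif
  · field_simp
    ring
  · rw [add_comm (h : ℝ) n]
    field_simp
    ring
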